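/- Let $A\in\mathbb R^{n\times n}$, $B\in\mathbb R^{n\times r}$, $C\in\mathbb R^{l\times n}$ with $\operatorname{rank}B=r$ and $l>r$, and let the system $\dot x=Ax+Bu$, $y=Cx$ be completely controllable (for all $t_0<t_1$ and all states $x_0,x_1$ some continuous control takes $x(t_0)=x_0$ to $x(t_1)=x_1$). **Definitions.** Let $K_k=[B,AB,\dots,A^{k-1}B]$ (with $\operatorname{rank}K_0=0$), let $\nu$ be the controllability index (the smallest $\nu$ with $\operatorname{rank}K_\nu=\operatorname{rank}K_n$), and let $l_i=\operatorname{rank}K_{\nu-i+1}-\operatorname{rank}K_{\nu-i}$ for $1\le i\le\nu$, so that $l_1\le\dots\le l_\nu=r$ and $l_1+\dots+l_\nu=n$. For $a\le b$ write $[O,I_a]$ for the $a\times b$ matrix whose last $a$ columns form the unit matrix and whose other columns vanish. A *Yokoyama reduction* consists of an invertible matrix $N$ and an $r\times r$ permutation matrix $M$ such that $$F=NAN^{-1}=\begin{bmatrix}O&E_{1,2}&&O\\ &\ddots&\ddots&\\ O&&O&E_{\nu-1,\nu}\\ F_{\nu1}&F_{\nu2}&\cdots&F_{\nu\nu}\end{bmatrix},\qquad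 G=NBM=\begin{bmatrix}O\\G_\nu\end{bmatrix},$$ where the blocks are taken with respect to the partition $n=l_1+\dots+l_\nu$, $E_{i,i+1}=[O,I_{l_i}]$ is of size $l_i\times l_{i+1}$, the last block row of $F$ is arbitrary, and $G_\nu$ is an $r\times r$ lower triangular matrix with unit diagonal whose diagonal blocks of orders $l_\nu-l_{\nu-1},\dots,l_2-l_1,l_1$ are unit matrices. Partition $CN^{-1}=[C_1,\dots,C_\nu]$ into $l\times l_i$ blocks and put $$\tilde C(s)=[O,C_1]+[O,C_2]s+\dots+[O,C_{\nu-1}]s^{\nu-2}+C_\nu s^{\nu-1},$$ an $l\times r$ polynomial matrix. Put $$P(s)=\begin{bmatrix}sI_n-A&-B\\C&O\end{bmatrix},\qquad \bar P(s)=\begin{bmatrix}sI_n-F&-G\\CN^{-1}&O\end{bmatrix}.$$ For $0\le k\le\min(r,l)$ consider the minors of $P(s)$ of order $n+k$ formed by rows $1,\dots,n,n+i_1,\dots,n+i_k$ and columns $1,\dots,n,n+j_1,\dots,n+j_k$, and let $\delta$ be the largest $k$ for which one of them is not identically zero. The *system zeros* are the complex zeros, counted with multiplicity, of the greatest common divisor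 of the not identically zero minors of this kind of order $n+\delta$. **Theorem.** A Yokoyama reduction exists, and every Yokoyama reduction has the following properties. First, $\det G_\nu\ne0$, and for all $1\le i_1<\dots<i_r\le l$ the function $s^{n-r\nu}\det\tilde C(s)^{i_1,\dots,i_r}$ is a polynomial and $$\bar P(s)^{1,\dots,n,n+i_1,\dots,n+i_r}_{1,\dots,n,n+1,\dots,n+r}=s^{n-r\nu}\det\tilde C(s)^{i_1,\dots,i_r}\cdot\det G_\nu,$$ where $\tilde C(s)^{i_1,\dots,i_r}$ consists of the rows $i_1,\dots,i_r$ of $\tilde C(s)$, and the left-hand side is the minor of $\bar P(s)$ with the indicated rows (above) and columns (below). Secondly, if $P(s)$ has normal rank $n+r$ (that is, rank $n+r$ over $\mathbb R(s)$), then the system zeros coincide, with multiplicities, with the zeros of the nonzero polynomial $\psi(s)$ that is the greatest common divisor of all not identically zero polynomials $s^{n-r\nu}\det\tilde C(s)^{i_1,\dots,i_r}$. -/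

import Mathlib

open Polynomial

/-- Complete state controllability of `ẋ = A x + B u`: for all times `t₀ < t₁` and all states
`x₀`, `x₁` there is a control `u` whose motion goes from `x₀` at time `t₀` to `x₁` at time `t₁`. -/
def IsControllable {n r : ℕ} (A : Matrix (Fin n) (Fin n) ℝ) (B : Matrix (Fin n) (Fin r) ℝ) :
    Prop :=
  ∀ t₀ t₁ : ℝ, t₀ < t₁ → ∀ x₀ x₁ : Fin n → ℝ,
    ∃ (u : ℝ → Fin r → ℝ) (x : ℝ → Fin n → ℝ), Continuous u ∧
      (∀ t, HasDerivAt x (A.mulVec (x t) + B.mulVec (u t)) t) ∧ x t₀ = x₀ ∧ x t₁ = x₁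

/-- The matrix `[B, AB, …, A^{k-1} B]`; its column `(i, j)` is the column `j` of `A^i B`. -/
def krylovMatrix {n r : ℕ} (A : Matrix (Fin n) (Fin n) ℝ) (B : Matrix (Fin n) (Fin r) ℝ)
    (k : ℕ) : Matrix (Fin n) (Fin k × Fin r) ℝ :=
  Matrix.of fun x c => (A ^ (c.1 : ℕ) * B) x c.2

/-- The controllability index of `(A, B)`: the smallest `ν` with
`rank [B, AB, …, A^{n-1} B] = rank [B, AB, …, A^{ν-1} B]`. -/
noncomputable def ctrlIndex {n r : ℕ} (A : Matrix (Fin n) (Fin n) ℝ)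
    (B : Matrix (Fin n) (Fin r) ℝ) : ℕ :=
  sInf {k : ℕ | (krylovMatrix A B n).rank = (krylovMatrix A B k).rank}

/-- The integers `l₁, …, l_ν`, numbered from `0`: `blockSize A B i` is
`l_{i+1} = rank [B, …, A^{ν-i-1} B] - rank [B, …, A^{ν-i-2} B]` (the last one is `rank B`).
The subtraction of ranks never truncates, because the second matrix is a part of the first. -/
noncomputable def blockSize {n r : ℕ} (A : Matrix (Fin n) (Fin n) ℝ)
    (B : Matrix (Fin n) (Fin r) ℝ) (i : Fin (ctrlIndex A B)) : ℕ :=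
  (krylovMatrix A B (ctrlIndex A B - i)).rank - (krylovMatrix A B (ctrlIndex A B - (i + 1))).rank

/-- Coordinates of the transformed state vector `z`, split into `ν` consecutive blocks of
lengths `l₁, …, l_ν`: `⟨i, a⟩` is the coordinate `a` of the block `i`. -/
abbrev BlockIndex {n r : ℕ} (A : Matrix (Fin n) (Fin n) ℝ) (B : Matrix (Fin n) (Fin r) ℝ) :
    Type :=
  (i : Fin (ctrlIndex A B)) × Fin (blockSize A B i)

/-- The `a × b` matrix `[O, I_a]` (for `a ≤ b`), whose last `a` columns form the unit matrix. -/
def zeroUnit (a b : ℕ) : Matrix (Fin a) (Fin b) ℝ :=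
  Matrix.of fun i j => if (j : ℕ) + a = i + b then 1 else 0

/-- The change of variables `z = N x`, `v = M⁻¹ u` (`N` invertible with inverse `Ninv`, `M` a
permutation matrix) brings `(A, B)` to Yokoyama's canonical form (generalized block companion
form) `F = N A N⁻¹`, `G = N B M`, where `Gν` is the lower `r × r` block of `G`. -/
structure IsYokoyama {n r : ℕ} (A : Matrix (Fin n) (Fin n) ℝ) (B : Matrix (Fin n) (Fin r) ℝ)
    (N : Matrix (BlockIndex A B) (Fin n) ℝ) (Ninv : Matrix (Fin n) (BlockIndex A B) ℝ)
    (M : Equiv.Perm (Fin r)) (Gν : Matrix (Fin r) (Fin r) ℝ) : Prop where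
  mul_inv : N * Ninv = 1
  inv_mul : Ninv * N = 1
  /-- Above the last block row, `F` has the blocks `E_{i,i+1} = [O, I_{l_i}]` right of the
  diagonal and zeros elsewhere; its last block row is arbitrary. -/
  companion : ∀ (i j : Fin (ctrlIndex A B)) (a : Fin (blockSize A B i))
    (b : Fin (blockSize A B j)), (i : ℕ) + 1 < ctrlIndex A B →
      (N * A * Ninv) ⟨i, a⟩ ⟨j, b⟩ =
        if (j : ℕ) = i + 1 then zeroUnit (blockSize A B i) (blockSize A B j) a b else 0
  /-- The block rows of `G` above the last one vanish. -/
  input_zero : ∀ (i : Fin (ctrlIndex A B)) (a : Fin (blockSize A B i)) (q : Fin r),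
    (i : ℕ) + 1 < ctrlIndex A B → (N * B * M.permMatrix ℝ) ⟨i, a⟩ q = 0
  /-- The last block row of `G` (it has `l_ν = rank B` rows) is `Gν`. -/
  input_last : ∀ (i : Fin (ctrlIndex A B)) (a : Fin (blockSize A B i)) (p q : Fin r),
    (i : ℕ) + 1 = ctrlIndex A B → (a : ℕ) = (p : ℕ) → (N * B * M.permMatrix ℝ) ⟨i, a⟩ q = Gν p q
  /-- `Gν` is lower triangular with unit diagonal. -/
  diag : ∀ p : Fin r, Gν p p = 1
  upper : ∀ p q : Fin r, p < q → Gν p q = 0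
  /-- The diagonal blocks of `Gν`, of orders `l_ν - l_{ν-1}, …, l₂ - l₁, l₁`, are unit matrices:
  `p` and `q` lie in the same block when no cut point `r - l_k` separates them. -/
  lower : ∀ p q : Fin r, q < p →
    (∀ k, (q : ℕ) + blockSize A B k < r ↔ (p : ℕ) + blockSize A B k < r) → Gν p q = 0

/-- The block `C_{i+1}`, of size `l × l_{i+1}`, of `C N⁻¹ = [C₁, …, C_ν]`. -/
def outputBlock {n r l : ℕ} {A : Matrix (Fin n) (Fin n) ℝ} {B : Matrix (Fin n) (Fin r) ℝ}
    (C : Matrix (Fin l) (Fin n) ℝ) (Ninv : Matrix (Fin n) (BlockIndex A B) ℝ)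
    (i : Fin (ctrlIndex A B)) : Matrix (Fin l) (Fin (blockSize A B i)) ℝ :=
  Matrix.of fun p a => (C * Ninv) p ⟨i, a⟩

/-- The `l × r` matrix polynomial
`C̃(s) = [O, C₁] + [O, C₂] s + ⋯ + [O, C_{ν-1}] s^{ν-2} + C_ν s^{ν-1}`,
with `[O, C_i]` written as the product `C_i [O, I_{l_i}]`. -/
noncomputable def outputPolynomial {n r l : ℕ} {A : Matrix (Fin n) (Fin n) ℝ}
    {B : Matrix (Fin n) (Fin r) ℝ} (C : Matrix (Fin l) (Fin n) ℝ)
    (Ninv : Matrix (Fin n) (BlockIndex A B) ℝ) : Matrix (Fin l) (Fin r) ℝ[X] :=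
  ∑ i : Fin (ctrlIndex A B),
    (X : ℝ[X]) ^ (i : ℕ) • (outputBlock C Ninv i * zeroUnit (blockSize A B i) r).map Polynomial.C

/-- Rosenbrock's system matrix `P(s) = [[sI - A, -B], [C, O]]`. -/
noncomputable def systemMatrix {ι κ o : Type*} [Fintype ι] [DecidableEq ι] (A : Matrix ι ι ℝ)
    (B : Matrix ι κ ℝ) (C : Matrix o ι ℝ) : Matrix (ι ⊕ o) (ι ⊕ κ) ℝ[X] :=
  Matrix.fromBlocks A.charmatrix (-B.map Polynomial.C) (C.map Polynomial.C) 0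

/-- The minor of `P(s)` with all `n` state rows and the output rows `i₁ < ⋯ < i_k`, all `n` state
columns and the input columns `j₁ < ⋯ < j_k`. -/
noncomputable def systemMinor {ι : Type*} [Fintype ι] [DecidableEq ι] {r l k : ℕ}
    (A : Matrix ι ι ℝ) (B : Matrix ι (Fin r) ℝ) (C : Matrix (Fin l) ι ℝ)
    (i : Fin k ↪o Fin l) (j : Fin k ↪o Fin r) : ℝ[X] :=
  ((systemMatrix A B C).submatrix (Sum.map id i) (Sum.map id j)).det

/-- The normal rank of a polynomial matrix: its rank over the field of rational functions. -/
noncomputable def normalRank {m m' : Type*} [Fintype m'] (P : Matrix m m' ℝ[X]) : ℕ :=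
  (P.map (algebraMap ℝ[X] (RatFunc ℝ))).rank

/-- The monic greatest common divisor of a set of polynomials (`0` if there is no nonzero
polynomial in the set). -/
noncomputable def polyGcd (S : Set ℝ[X]) : ℝ[X] :=
  normalize (Submodule.IsPrincipal.generator (Ideal.span S))

theorem polyGcd_dvd {S : Set ℝ[X]} {p : ℝ[X]} (hp : p ∈ S) : polyGcd S ∣ p := by
  rw [polyGcd, normalize_dvd_iff]
  exact (Submodule.IsPrincipal.mem_iff_generator_dvd _).1 (Ideal.subset_span hp)

theorem dvd_polyGcd {S : Set ℝ[X]} {d : ℝ[X]} (hd : ∀ p ∈ S, d ∣ p) : d ∣ polyGcd S := by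
  rw [polyGcd, dvd_normalize_iff, ← Ideal.mem_span_singleton]
  refine (Ideal.span_le.2 fun p hp => ?_) (Submodule.IsPrincipal.generator_mem (Ideal.span S))
  exact Ideal.mem_span_singleton.2 (hd p hp)

/-- The complex zeros of a real polynomial, with multiplicities. -/
noncomputable def zeros (ψ : ℝ[X]) : Multiset ℂ :=
  (ψ.map (algebraMap ℝ ℂ)).roots

/-- The largest `k` for which some minor `systemMinor A B C i j` of order `n + k` is not
identically zero (`k = 0` always qualifies, and `k ≤ min r l` as `i` and `j` are injective). -/
noncomputable def maxMinorOrder {n r l : ℕ} (A : Matrix (Fin n) (Fin n) ℝ)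
    (B : Matrix (Fin n) (Fin r) ℝ) (C : Matrix (Fin l) (Fin n) ℝ) : ℕ :=
  sSup {k : ℕ | ∃ (i : Fin k ↪o Fin l) (j : Fin k ↪o Fin r), systemMinor A B C i j ≠ 0}

/-- The complete set of system zeros (with multiplicities): the zeros of the greatest common
divisor of the non identically zero minors `systemMinor A B C i j` of the largest order. -/
noncomputable def systemZeros {n r l : ℕ} (A : Matrix (Fin n) (Fin n) ℝ)
    (B : Matrix (Fin n) (Fin r) ℝ) (C : Matrix (Fin l) (Fin n) ℝ) : Multiset ℂ :=
  zeros (polyGcd {p : ℝ[X] | p ≠ 0 ∧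
    ∃ (i : Fin (maxMinorOrder A B C) ↪o Fin l) (j : Fin (maxMinorOrder A B C) ↪o Fin r),
      p = systemMinor A B C i j})

/-- `s^{n - rν} det C̃(s)^{i₁, …, i_r}`, where `C̃(s)^{i₁, …, i_r}` consists of the rows
`i₁ < ⋯ < i_r` of `C̃(s)`; the exponent is an integer `≤ 0`, so this is written as a rational
function of `s`. -/
noncomputable def scaledMinor {n r l : ℕ} {A : Matrix (Fin n) (Fin n) ℝ}
    {B : Matrix (Fin n) (Fin r) ℝ} (C : Matrix (Fin l) (Fin n) ℝ)
    (Ninv : Matrix (Fin n) (BlockIndex A B) ℝ) (i : Fin r ↪o Fin l) : RatFunc ℝ :=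
  RatFunc.X ^ ((n : ℤ) - (r : ℤ) * (ctrlIndex A B : ℤ)) *
    algebraMap ℝ[X] (RatFunc ℝ) ((outputPolynomial C Ninv).submatrix i id).det

/-- The greatest common divisor of all non identically zero `s^{n - rν} det C̃(s)^{i₁, …, i_r}`
(as polynomials). -/
noncomputable def outputGcd {n r l : ℕ} {A : Matrix (Fin n) (Fin n) ℝ}
    {B : Matrix (Fin n) (Fin r) ℝ} (C : Matrix (Fin l) (Fin n) ℝ)
    (Ninv : Matrix (Fin n) (BlockIndex A B) ℝ) : ℝ[X] :=
  polyGcd {p : ℝ[X] | p ≠ 0 ∧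
    ∃ i : Fin r ↪o Fin l, algebraMap ℝ[X] (RatFunc ℝ) p = scaledMinor C Ninv i}

/-! Minor formula (`IsYokoyama.systemMinor_eq`). State feedback, a column operation of determinant
one, deletes the last block row of `F` from `sI - F`. What remains, `D₀`, is block triangular with
determinant `s ^ n`, and `D₀ Q = s J` has an explicit solution: block `i` of `Q` (numbered from `0`)
is `s ^ (i + 1 - ν) [O, I]`, where `J` embeds the last block. A second column operation then clears
the input columns and leaves `C N⁻¹ Q = s ^ (1 - ν) C̃(s)` below. Comparing determinants gives the
power `s ^ (n - rν)`. As `det Gν = 1`, the scaled minor equals a minor of a polynomial matrix and is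
itself a polynomial.

System zeros (`systemZeros_eq_zeros_outputGcd`). Passing from `P` to its reduced form multiplies
each minor of order `n + r` by `det M = ±1`. Normal rank `n + r` makes one of these minors nonzero,
so `δ = r`, and the two gcds are taken over associated polynomials.

Existence (`exists_isYokoyama`). Controllability gives `rank K_n = n`. A greedy choice among the `A
^ k b_j` yields a basis made of chains `b_j, …, A ^ (μ j - 1) b_j`, and the `l_i` count the chains
of at least a given length. With `φ j` the dual functional of the last vector of chain `j`, the rows
of `N` are the `φ j ∘ A ^ k` with `k < μ j`, the chains sorted by length. Multiplication by `A`
moves each row above the last block to another row, which gives the companion shape. -/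

/-! ### Chains of Krylov vectors and the ranks of the Krylov matrices. -/

theorem linearIndepOn_of_notMem_span_lt {K V ι : Type*} [DivisionRing K] [AddCommGroup V]
    [Module K V] [LinearOrder ι] (v : ι → V) (s : Finset ι)
    (h : ∀ x ∈ s, v x ∉ Submodule.span K (v '' {y | y < x})) :
    LinearIndepOn K v (s : Set ι) := by
  induction s using Finset.induction_on_max with
  | empty => simp
  | insert a s ha ih =>
    rw [Finset.coe_insert, linearIndepOn_insert (fun h' => (ha a h').false)]
    refine ⟨ih fun x hx => h x (Finset.mem_insert_of_mem hx), fun hmem => ?_⟩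
    exact h a (Finset.mem_insert_self a s)
      (Submodule.span_mono (Set.image_mono fun x hx => ha x hx) hmem)

/-- Well-founded induction: a rejected vector is a combination of earlier ones, which are already
combinations of selected vectors. The bound `y ≤ x` is kept because it later bounds the powers of
`A` involved. -/
theorem mem_span_of_selected {K V ι : Type*} [DivisionRing K] [AddCommGroup V]
    [Module K V] [LinearOrder ι] [WellFoundedLT ι] (v : ι → V) (x : ι) :
    v x ∈ Submodule.span K
      (v '' {y | y ≤ x ∧ v y ∉ Submodule.span K (v '' {z | z < y})}) := by
  induction x using WellFoundedLT.induction with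
  | ind x ih =>
    by_cases hx : v x ∈ Submodule.span K (v '' {z | z < x})
    · refine Submodule.span_le.2 ?_ hx
      rintro _ ⟨z, hz, rfl⟩
      refine Submodule.span_mono (Set.image_mono ?_) (ih z hz)
      exact fun y hy => ⟨hy.1.trans (le_of_lt hz), hy.2⟩
    · exact Submodule.subset_span ⟨x, ⟨le_rfl, hx⟩, rfl⟩

/-- The column `j` of `A ^ k * B`. -/
def krylovVec {n r : ℕ} (A : Matrix (Fin n) (Fin n) ℝ) (B : Matrix (Fin n) (Fin r) ℝ)
    (x : ℕ × Fin r) : Fin n → ℝ :=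
  (A ^ x.1 * B).col x.2

section Krylov

variable {n r : ℕ} (A : Matrix (Fin n) (Fin n) ℝ) (B : Matrix (Fin n) (Fin r) ℝ)

theorem pow_mulVec_krylovVec (e k : ℕ) (j : Fin r) :
    (A ^ e).mulVec (krylovVec A B (k, j)) = krylovVec A B (e + k, j) := by
  ext x
  simp [krylovVec, pow_add, Matrix.mul_assoc, Matrix.mul_apply (M := A ^ e), Matrix.mulVec,
    dotProduct]

theorem span_col_krylovMatrix (k : ℕ) :
    Submodule.span ℝ (Set.range (krylovMatrix A B k).col) =
      Submodule.span ℝ (krylovVec A B '' {x | x.1 < k}) := by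
  congr 1
  ext v
  constructor
  · rintro ⟨⟨i, j⟩, rfl⟩
    exact ⟨(i, j), i.2, rfl⟩
  · rintro ⟨⟨i, j⟩, hi, rfl⟩
    exact ⟨(⟨i, hi⟩, j), rfl⟩

theorem rank_krylovMatrix (k : ℕ) :
    (krylovMatrix A B k).rank =
      Module.finrank ℝ (Submodule.span ℝ (krylovVec A B '' {x | x.1 < k})) := by
  rw [Matrix.rank_eq_finrank_span_cols, span_col_krylovMatrix]

/-- The chain lengths of a Krylov basis: the vectors `A ^ k b_j` with `k < μ j` are linearly
independent, and those among them with `k ≤ m` span all `A ^ k b_j` with `k ≤ m`. -/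
structure IsKrylovSelection (μ : Fin r → ℕ) : Prop where
  indep : LinearIndepOn ℝ (krylovVec A B) {x | x.1 < μ x.2}
  span : ∀ k j, krylovVec A B (k, j) ∈
    Submodule.span ℝ (krylovVec A B '' {x | x.1 ≤ k ∧ x.1 < μ x.2})

/-- Greedy selection in lexicographic order, exponent first. Once `A ^ k b_j` is rejected, so are
all higher powers on `b_j`; hence the selected vectors form chains starting at exponent `0`. -/
theorem exists_isKrylovSelection (hK : (krylovMatrix A B n).rank = n) :
    ∃ μ : Fin r → ℕ, IsKrylovSelection A B μ := by
  classical
  have htop : Submodule.span ℝ (krylovVec A B '' {x | x.1 < n}) = ⊤ := by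
    apply Submodule.eq_top_of_finrank_eq
    rw [← rank_krylovMatrix, hK]
    simp
  let v : ℕ ×ₗ Fin r → Fin n → ℝ := fun x => krylovVec A B (ofLex x)
  let sel : ℕ → Fin r → Prop := fun k j =>
    v (toLex (k, j)) ∉ Submodule.span ℝ (v '' {z | z < toLex (k, j)})
  -- Applying `A` raises every exponent by one, which preserves the lexicographic order.
  have hstep : ∀ k j, ¬ sel k j → ¬ sel (k + 1) j := by
    intro k j h
    simp only [sel, not_not] at h ⊢
    have h2 := Submodule.mem_map_of_mem (f := A.mulVecLin) h
    rw [Submodule.map_span] at h2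
    have hA : ∀ k j, A.mulVecLin (krylovVec A B (k, j)) = krylovVec A B (k + 1, j) := by
      intro k j
      have := pow_mulVec_krylovVec A B 1 k j
      rwa [pow_one, add_comm] at this
    change A.mulVecLin (krylovVec A B (k, j)) ∈ _ at h2
    rw [hA] at h2
    refine Submodule.span_mono ?_ h2
    rintro _ ⟨_, ⟨⟨k', j'⟩, hz, rfl⟩, rfl⟩
    refine ⟨toLex (k' + 1, j'), ?_, (hA k' j').symm⟩
    change toLex (k', j') < toLex (k, j) at hz
    change toLex (k' + 1, j') < toLex (k + 1, j)
    rw [Prod.Lex.toLex_lt_toLex] at hz ⊢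
    simpa using hz
  -- All vectors with exponent below `n` precede `(n, j)` and already span the space, so every chain
  -- has length at most `n`.
  have hn : ∀ j, ¬ sel n j := by
    intro j
    simp only [sel, not_not]
    have : v (toLex (n, j)) ∈ Submodule.span ℝ (krylovVec A B '' {x | x.1 < n}) := by
      rw [htop]; trivial
    refine Submodule.span_mono ?_ this
    rintro _ ⟨⟨k', j'⟩, hz, rfl⟩
    exact ⟨toLex (k', j'), by simpa [Prod.Lex.toLex_lt_toLex] using Or.inl hz, rfl⟩
  have hex : ∀ j, ∃ k, ¬ sel k j := fun j => ⟨n, hn j⟩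
  let μ : Fin r → ℕ := fun j => Nat.find (hex j)
  have hμ : ∀ k j, sel k j ↔ k < μ j := by
    intro k j
    refine ⟨fun h => ?_, fun h => not_not.1 (Nat.find_min (hex j) h)⟩
    by_contra hlt
    have : ∀ m, ¬ sel (μ j + m) j := by
      intro m
      induction m with
      | zero => exact Nat.find_spec (hex j)
      | succ m ih => exact hstep _ _ ih
    obtain ⟨m, rfl⟩ := Nat.exists_eq_add_of_le (not_lt.1 hlt)
    exact this m h
  refine ⟨μ, ⟨?_, fun k j => ?_⟩⟩
  · let s : Finset (ℕ ×ₗ Fin r) :=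
      ((Finset.range n ×ˢ (Finset.univ : Finset (Fin r))).filter
        (fun x => x.1 < μ x.2)).map toLex.toEmbedding
    have hs := linearIndepOn_of_notMem_span_lt (K := ℝ) v s (by
      intro x hx
      obtain ⟨⟨k, j⟩, hkj, rfl⟩ := Finset.mem_map.1 hx
      exact (hμ k j).2 (Finset.mem_filter.1 hkj).2)
    have := (hs.comp (fun x : {x : ℕ × Fin r | x.1 < μ x.2} => (⟨toLex x.1, by
      simp only [s, Finset.coe_map, Set.mem_image, Finset.mem_coe, Finset.mem_filter]
      refine ⟨x.1, ⟨?_, x.2⟩, rfl⟩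
      have h1 : x.1.1 < μ x.1.2 := x.2
      have h2 : μ x.1.2 ≤ n := Nat.find_min' _ (hn _)
      simp; omega⟩ : (s : Set (ℕ ×ₗ Fin r)))) (fun x y h => by
        apply Subtype.ext
        simpa using h))
    exact this
  · refine Submodule.span_mono ?_ (mem_span_of_selected (K := ℝ) v (toLex (k, j)))
    rintro _ ⟨⟨k', j'⟩, ⟨hle, hsel⟩, rfl⟩
    refine ⟨(k', j'), ⟨?_, (hμ k' j').1 hsel⟩, rfl⟩
    change toLex (k', j') ≤ toLex (k, j) at hle
    rw [Prod.Lex.toLex_le_toLex] at hle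
    simp at hle ⊢
    omega

variable {A B}

/-- The selected vectors with exponent below `k` form a basis of the column space; they are counted
layer by layer in the exponent. -/
theorem IsKrylovSelection.rank_krylovMatrix {μ : Fin r → ℕ} (h : IsKrylovSelection A B μ)
    (k : ℕ) : (krylovMatrix A B k).rank =
      ∑ i ∈ Finset.range k, (Finset.univ.filter fun j => i < μ j).card := by
  classical
  let s : Finset (ℕ × Fin r) :=
    (Finset.range k ×ˢ (Finset.univ : Finset (Fin r))).filter (fun x => x.1 < μ x.2)
  have hspan : Submodule.span ℝ (krylovVec A B '' {x | x.1 < k}) =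
      Submodule.span ℝ (krylovVec A B '' s) := by
    apply le_antisymm
    · rw [Submodule.span_le]
      rintro _ ⟨⟨i, j⟩, hi, rfl⟩
      refine Submodule.span_mono (Set.image_mono ?_) (h.span i j)
      rintro ⟨i', j'⟩ ⟨h1, h2⟩
      have hi : i < k := hi
      simp [s] at h1 h2 ⊢
      omega
    · refine Submodule.span_mono (Set.image_mono ?_)
      rintro ⟨i', j'⟩ h'
      simp [s] at h' ⊢
      omega
  have hli : LinearIndepOn ℝ (krylovVec A B) (s : Set (ℕ × Fin r)) := by
    refine h.indep.mono ?_
    rintro ⟨i', j'⟩ h'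
    simp [s] at h' ⊢
    omega
  rw [_root_.rank_krylovMatrix, hspan, Set.image_eq_range, finrank_span_eq_card hli]
  simp only [Finset.coe_sort_coe, Fintype.card_coe, s]
  rw [Finset.card_filter, Finset.sum_product]
  exact Finset.sum_congr rfl fun i _ => (Finset.card_filter _ _).symm

end Krylov

/-! ### Controllability implies full Krylov rank. -/

theorem eq_zero_of_hasDerivAt_clm {E : Type*} [NormedAddCommGroup E] [NormedSpace ℝ E]
    (T : E →L[ℝ] E) {y : ℝ → E} (hy : ∀ t, HasDerivAt y (T (y t)) t) {t₀ : ℝ}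
    (h₀ : y t₀ = 0) : y = 0 :=
  ODE_solution_unique_univ (v := fun _ => T) (s := fun _ => Set.univ) (K := ‖T‖₊)
    (fun _ => T.lipschitz.lipschitzOnWith) (fun t => ⟨hy t, trivial⟩)
    (fun t => ⟨by simp, trivial⟩) h₀

/-- A motion starting at `0` cannot leave `W`: its component `p x` in a complement satisfies the
homogeneous linear equation `y' = p A y` with `y 0 = 0`, hence vanishes by uniqueness. -/
theorem IsControllable.eq_top {n r : ℕ} {A : Matrix (Fin n) (Fin n) ℝ}
    {B : Matrix (Fin n) (Fin r) ℝ} (h : IsControllable A B) (W : Submodule ℝ (Fin n → ℝ))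
    (hA : ∀ v ∈ W, A.mulVec v ∈ W) (hB : ∀ u, B.mulVec u ∈ W) : W = ⊤ := by
  obtain ⟨W', hW⟩ := W.exists_isCompl
  let p : (Fin n → ℝ) →ₗ[ℝ] (Fin n → ℝ) := W'.projection W hW.symm
  have hp : ∀ v, p v = 0 ↔ v ∈ W := fun v => Submodule.projection_apply_eq_zero_iff hW.symm
  have hpp : ∀ v, v - p v ∈ W := Submodule.sub_projection_mem hW.symm
  rw [eq_top_iff]
  intro x₁ _
  obtain ⟨u, x, -, hx, h0, h1⟩ := h 0 1 one_pos 0 x₁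
  rw [← hp, ← h1]
  let T := LinearMap.toContinuousLinearMap (p ∘ₗ A.mulVecLin)
  have := eq_zero_of_hasDerivAt_clm T (y := fun t => p (x t)) (t₀ := 0) (by
    intro t
    have hd := (LinearMap.toContinuousLinearMap p).hasFDerivAt.comp_hasDerivAt t (hx t)
    have he : LinearMap.toContinuousLinearMap p (A.mulVec (x t) + B.mulVec (u t)) =
        T (p (x t)) := by
      have h1 : p (B.mulVec (u t)) = 0 := (hp _).2 (hB _)
      have h2 : p (A.mulVec (x t - p (x t))) = 0 := (hp _).2 (hA _ (hpp _))
      rw [Matrix.mulVec_sub, map_sub, sub_eq_zero] at h2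
      simpa [T, h1] using h2
    rw [he] at hd
    exact hd) (by simp [h0])
  exact congrFun this 1

/-- By Cayley–Hamilton the span of the `A ^ k b_j` with `k < n` contains all higher powers too, so
it is `A`-invariant and contains the range of `B`. -/
theorem IsControllable.rank_krylovMatrix {n r : ℕ} {A : Matrix (Fin n) (Fin n) ℝ}
    {B : Matrix (Fin n) (Fin r) ℝ} (h : IsControllable A B) : (krylovMatrix A B n).rank = n := by
  rw [_root_.rank_krylovMatrix]
  have hmem : ∀ k j, krylovVec A B (k, j) ∈
      Submodule.span ℝ (krylovVec A B '' {x | x.1 < n}) := by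
    intro k j
    have hmod : A ^ k = Polynomial.aeval A ((X : ℝ[X]) ^ k %ₘ A.charpoly) :=
      Matrix.pow_eq_aeval_mod_charpoly A k
    -- For `n = 0` the remainder is `0`, whose `natDegree` is `0` and not below `n`.
    have hdeg : ((X : ℝ[X]) ^ k %ₘ A.charpoly).natDegree < n ∨ n = 0 := by
      rcases Nat.eq_zero_or_pos n with h0 | h0
      · exact Or.inr h0
      · left
        have := Polynomial.natDegree_modByMonic_lt ((X : ℝ[X]) ^ k) A.charpoly_monic (by
          intro h1
          have := A.charpoly_natDegree_eq_dim
          rw [h1] at this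
          simp at this
          omega)
        rwa [A.charpoly_natDegree_eq_dim, Fintype.card_fin] at this
    rcases hdeg with hdeg | rfl
    · rw [Polynomial.aeval_eq_sum_range' hdeg] at hmod
      have : krylovVec A B (k, j) =
          ∑ i ∈ Finset.range n, ((X : ℝ[X]) ^ k %ₘ A.charpoly).coeff i • krylovVec A B (i, j) := by
        ext x
        simp [krylovVec, hmod, Matrix.sum_mul, Matrix.sum_apply]
      rw [this]
      refine Submodule.sum_mem _ fun i hi => Submodule.smul_mem _ _ (Submodule.subset_span ?_)
      exact ⟨(i, j), Finset.mem_range.1 hi, rfl⟩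
    · rw [Subsingleton.elim (krylovVec A B (k, j)) 0]
      exact Submodule.zero_mem _
  have := h.eq_top (Submodule.span ℝ (krylovVec A B '' {x | x.1 < n})) (by
    intro v hv
    have hv := Submodule.mem_map_of_mem (f := A.mulVecLin) hv
    rw [Submodule.map_span] at hv
    refine Submodule.span_le.2 ?_ hv
    rintro _ ⟨_, ⟨⟨k, j⟩, -, rfl⟩, rfl⟩
    have := pow_mulVec_krylovVec A B 1 k j
    rw [pow_one] at this
    simp only [Matrix.mulVecLin_apply, this]
    exact hmem _ _) (by
    intro u
    rw [Matrix.mulVec_eq_sum]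
    refine Submodule.sum_mem _ fun j _ => ?_
    have := hmem 0 j
    simp only [krylovVec, pow_zero, Matrix.one_mul] at this
    rw [op_smul_eq_smul]
    exact Submodule.smul_mem _ (u j) this)
  rw [this, finrank_top]
  simp

/-! ### The minor formula for the canonical form. -/

/-- The determinant of a bordered matrix through state feedback `D₀ = D + J R`. -/
theorem det_fromBlocks_zero_feedback {K ι κ : Type*} [Field K] [Fintype ι] [DecidableEq ι]
    [Fintype κ] [DecidableEq κ] (s : K) (hs : s ≠ 0) (D : Matrix ι ι K) (D₀ : Matrix ι ι K)
    (J : Matrix ι κ K) (R : Matrix κ ι K) (g : Matrix κ κ K) (H : Matrix κ ι K)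
    (Q : Matrix ι κ K) (hD : D₀ = D + J * R) (hQ : D₀ * Q = s • J) (hg : g.det ≠ 0) :
    (Matrix.fromBlocks D (-(J * g)) H 0).det * s ^ Fintype.card κ =
      D₀.det * (H * Q).det * g.det := by
  have hu : IsUnit g.det := isUnit_iff_ne_zero.2 hg
  -- The first factor is the feedback and turns `D` into `D₀`; the second clears the upper right
  -- block, since `D₀ Q = s J`. Their determinants are `1` and `s ^ |κ| / det g`.
  have h1 : Matrix.fromBlocks D (-(J * g)) H 0 *
      (Matrix.fromBlocks 1 0 (-(g⁻¹ * R)) 1 * Matrix.fromBlocks 1 Q 0 (s • g⁻¹)) =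
      Matrix.fromBlocks D₀ 0 H (H * Q) := by
    have e1 : J * g * (g⁻¹ * R) = J * R := by
      rw [Matrix.mul_assoc, ← Matrix.mul_assoc g, Matrix.mul_nonsing_inv _ hu, Matrix.one_mul]
    have e2 : J * g * (s • g⁻¹) = s • J := by
      rw [Matrix.mul_smul, Matrix.mul_assoc, Matrix.mul_nonsing_inv _ hu, Matrix.mul_one]
    rw [← Matrix.mul_assoc, Matrix.fromBlocks_multiply, Matrix.fromBlocks_multiply]
    congr 1
    · simp [e1, hD]
    · simp only [Matrix.mul_zero, Matrix.mul_one, Matrix.neg_mul, Matrix.mul_neg, e1, neg_neg,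
        ← hD, hQ, zero_add]
      rw [e2, add_neg_cancel]
    · simp
    · simp
  have h2 := congrArg Matrix.det h1
  rw [Matrix.det_mul, Matrix.det_mul, Matrix.det_fromBlocks_zero₁₂, Matrix.det_fromBlocks_zero₂₁,
    Matrix.det_fromBlocks_zero₁₂, Matrix.det_smul, Matrix.det_nonsing_inv] at h2
  simp only [Matrix.det_one, one_mul, Ring.inverse_eq_inv'] at h2
  rw [← h2]
  field_simp

/-- A matrix over a sigma type with `s` on the diagonal and zeros elsewhere in and below the
diagonal blocks. -/
theorem det_eq_pow_of_blocks {K : Type*} [Field K] {ν : ℕ} {b : Fin ν → ℕ}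
    (D : Matrix ((i : Fin ν) × Fin (b i)) ((i : Fin ν) × Fin (b i)) K) (s : K)
    (hD : ∀ x y, y.1 ≤ x.1 → D x y = if x = y then s else 0) :
    D.det = s ^ (∑ i, b i) := by
  have ht : D.BlockTriangular Sigma.fst := by
    intro x y hxy
    rw [hD x y hxy.le, if_neg]
    rintro rfl
    exact hxy.false
  rw [ht.det_fintype, ← Finset.prod_pow_eq_pow_sum]
  refine Finset.prod_congr rfl fun k _ => ?_
  have : D.toSquareBlock Sigma.fst k = Matrix.diagonal fun _ => s := by
    ext x y
    rw [Matrix.toSquareBlock_def, Matrix.of_apply, hD _ _ (by rw [x.2, y.2]),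
      Matrix.diagonal_apply]
    simp [Subtype.ext_iff]
  rw [this, Matrix.det_diagonal, Finset.prod_const, Finset.card_univ]
  congr 1
  rw [Fintype.card_congr (Equiv.sigmaSubtype k), Fintype.card_fin]

theorem sum_zeroUnit_mul {R : Type*} [CommSemiring R] {a b : ℕ} (hab : a ≤ b) (i : Fin a)
    (f : Fin b → R) (c : ℝ →+* R) :
    ∑ j, c (zeroUnit a b i j) * f j = f ⟨i + (b - a), by omega⟩ := by
  rw [Finset.sum_eq_single ⟨i + (b - a), by omega⟩]
  · rw [zeroUnit, Matrix.of_apply, if_pos (by simp; omega), map_one, one_mul]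
  · intro j _ hj
    rw [zeroUnit, Matrix.of_apply, if_neg, map_zero, zero_mul]
    intro h
    apply hj
    ext
    simp
    omega
  · simp

section Minor

variable {n r l : ℕ} {A : Matrix (Fin n) (Fin n) ℝ} {B : Matrix (Fin n) (Fin r) ℝ}
  {N : Matrix (BlockIndex A B) (Fin n) ℝ} {Ninv : Matrix (Fin n) (BlockIndex A B) ℝ}
  {M : Equiv.Perm (Fin r)} {Gν : Matrix (Fin r) (Fin r) ℝ}

theorem IsYokoyama.det_eq_one (h : IsYokoyama A B N Ninv M Gν) : Gν.det = 1 := by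
  rw [Matrix.det_of_isLowerTriangular _ fun p q hpq => h.upper p q hpq]
  simp [h.diag]

/-- The block sizes increase from block to block up to `r` and add up to `n`. -/
structure BlockSizeSpec (A : Matrix (Fin n) (Fin n) ℝ) (B : Matrix (Fin n) (Fin r) ℝ) : Prop where
  mono : ∀ i j : Fin (ctrlIndex A B), (j : ℕ) = i + 1 → blockSize A B i ≤ blockSize A B j
  last : ∀ i : Fin (ctrlIndex A B), (i : ℕ) + 1 = ctrlIndex A B → blockSize A B i = r
  le : ∀ i, blockSize A B i ≤ r
  sum : ∑ i, blockSize A B i = n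

theorem IsYokoyama.systemMinor_eq (h : IsYokoyama A B N Ninv M Gν) (hb : BlockSizeSpec A B)
    (C : Matrix (Fin l) (Fin n) ℝ) (i : Fin r ↪o Fin l) :
    algebraMap ℝ[X] (RatFunc ℝ)
        (systemMinor (N * A * Ninv) (N * B * M.permMatrix ℝ) (C * Ninv) i
          (RelEmbedding.refl (· ≤ ·))) =
      scaledMinor C Ninv i * RatFunc.C Gν.det := by
  set F := N * A * Ninv
  set G := N * B * M.permMatrix ℝ
  set ν := ctrlIndex A B
  let s : RatFunc ℝ := RatFunc.X
  have hs : s ≠ 0 := RatFunc.X_ne_zero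
  let c : ℝ →+* RatFunc ℝ := RatFunc.C
  have hc : ∀ x, algebraMap ℝ[X] (RatFunc ℝ) (Polynomial.C x) = c x := RatFunc.algebraMap_C
  let D : Matrix (BlockIndex A B) (BlockIndex A B) (RatFunc ℝ) := s • 1 - F.map c
  -- `J` embeds the last block, `R` is the last block row of `F`, so `D₀` is `sI - F` without that
  -- row. `Q` has negative powers of `s`, hence the field `RatFunc ℝ`.
  let J : Matrix (BlockIndex A B) (Fin r) (RatFunc ℝ) :=
    Matrix.of fun x p => if (x.1 : ℕ) + 1 = ν ∧ (x.2 : ℕ) = p then 1 else 0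
  let R : Matrix (Fin r) (BlockIndex A B) (RatFunc ℝ) :=
    Matrix.of fun p y => ∑ x : BlockIndex A B, J x p * c (F x y)
  let D₀ := D + J * R
  let Q : Matrix (BlockIndex A B) (Fin r) (RatFunc ℝ) :=
    Matrix.of fun x q => s ^ ((x.1 : ℤ) + 1 - ν) * c (zeroUnit (blockSize A B x.1) r x.2 q)
  let H : Matrix (Fin r) (BlockIndex A B) (RatFunc ℝ) := ((C * Ninv).map c).submatrix i id
  have hJlast : ∀ (x : BlockIndex A B) (hx : (x.1 : ℕ) + 1 = ν) (f : Fin r → RatFunc ℝ),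
      ∑ p, J x p * f p = f ⟨x.2, by have := hb.last x.1 hx; omega⟩ := by
    intro x hx f
    rw [Finset.sum_eq_single ⟨x.2, by have := hb.last x.1 hx; omega⟩]
    · simp [J, hx]
    · intro p _ hp
      simp only [J, Matrix.of_apply, hx, true_and]
      rw [if_neg, zero_mul]
      rintro h'
      exact hp (Fin.ext h'.symm)
    · simp
  have hJnot : ∀ (x : BlockIndex A B) (p : Fin r), (x.1 : ℕ) + 1 ≠ ν → J x p = 0 := by
    intro x p hx
    simp [J, hx]
  have hJR : ∀ x y, (J * R) x y = if (x.1 : ℕ) + 1 = ν then c (F x y) else 0 := by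
    intro x y
    rw [Matrix.mul_apply]
    split_ifs with hx
    · rw [hJlast x hx (fun p => R p y)]
      simp only [R, Matrix.of_apply]
      rw [Finset.sum_eq_single x]
      · simp [J, hx]
      · intro z _ hz
        simp only [J, Matrix.of_apply]
        rw [if_neg, zero_mul]
        rintro ⟨h1, h2⟩
        apply hz
        have h3 : z.1 = x.1 := Fin.ext (by omega)
        obtain ⟨z1, z2⟩ := z
        obtain ⟨x1, x2⟩ := x
        obtain rfl : z1 = x1 := h3
        obtain rfl : z2 = x2 := Fin.ext h2
        rfl
      · simp
    · exact Finset.sum_eq_zero fun p _ => by rw [hJnot x p hx, zero_mul]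
  have hD₀ : ∀ x y, D₀ x y = s * (1 : Matrix (BlockIndex A B) (BlockIndex A B) (RatFunc ℝ)) x y -
      if (x.1 : ℕ) + 1 = ν then 0 else c (F x y) := by
    intro x y
    simp only [D₀, D, Matrix.add_apply, hJR, Matrix.sub_apply, Matrix.smul_apply, smul_eq_mul,
      Matrix.map_apply]
    split_ifs <;> ring
  have hlt : ∀ x : BlockIndex A B, (x.1 : ℕ) + 1 ≠ ν → (x.1 : ℕ) + 1 < ν := fun x hx => by
    have := x.1.2
    omega
  -- Row by row: the last block of `Q` is the unit matrix, and above it `s Q_i = [O, I] Q_{i+1}`,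
  -- which only shifts indices and lowers the exponent by one.
  have hQ : D₀ * Q = s • J := by
    ext x q
    rw [Matrix.mul_apply]
    simp only [hD₀, sub_mul, Finset.sum_sub_distrib, Matrix.smul_apply, smul_eq_mul, mul_assoc,
      ← Finset.mul_sum]
    rw [← Matrix.mul_apply, Matrix.one_mul]
    by_cases hx : (x.1 : ℕ) + 1 = ν
    · have hl := hb.last x.1 hx
      have h0 : (x.1 : ℤ) + 1 - ν = 0 := by omega
      simp only [hx, if_true, zero_mul, Finset.sum_const_zero, sub_zero, true_and, Q,
        Matrix.of_apply, J, h0, zpow_zero, one_mul, zeroUnit]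
      have : ((q : ℕ) + blockSize A B x.1 = x.2 + r) ↔ ((x.2 : ℕ) = q) := by omega
      simp [this]
    · rw [hJnot x q hx, mul_zero, sub_eq_zero]
      simp only [hx, if_false]
      have hx' := hlt x hx
      let j : Fin ν := ⟨x.1 + 1, hx'⟩
      have hm := hb.mono x.1 j rfl
      rw [Fintype.sum_sigma, Finset.sum_eq_single j]
      · have e : ∀ b : Fin (blockSize A B j), F x ⟨j, b⟩ =
            zeroUnit (blockSize A B x.1) (blockSize A B j) x.2 b := by
          intro b
          have := h.companion x.1 j x.2 b hx'
          rwa [if_pos rfl] at this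
        simp only [e]
        rw [sum_zeroUnit_mul hm]
        simp only [Q, Matrix.of_apply]
        have e2 : (((j : ℕ) : ℤ) + 1 - ν) = ((x.1 : ℤ) + 1 - ν) + 1 := by simp [j]; ring
        rw [e2, zpow_add_one₀ hs]
        have e3 : zeroUnit (blockSize A B x.1) r x.2 q =
            zeroUnit (blockSize A B j) r ⟨x.2 + (blockSize A B j - blockSize A B x.1), by omega⟩ q := by
          simp only [zeroUnit, Matrix.of_apply]
          congr 1
          simp only [eq_iff_iff]
          omega
        rw [e3]
        ring
      · intro k _ hk
        refine Finset.sum_eq_zero fun b _ => ?_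
        have := h.companion x.1 k x.2 b hx'
        rw [if_neg (fun h' => hk (Fin.ext h'))] at this
        rw [show F x ⟨k, b⟩ = 0 from this, map_zero, zero_mul]
      · simp
  have hdet : D₀.det = s ^ n := by
    refine (det_eq_pow_of_blocks D₀ s fun x y hxy => ?_).trans (congrArg (s ^ ·) hb.sum)
    rw [hD₀, Matrix.one_apply]
    have : (if (x.1 : ℕ) + 1 = ν then 0 else c (F x y)) = 0 := by
      split_ifs with hx
      · rfl
      · have := h.companion x.1 y.1 x.2 y.2 (hlt x hx)
        have hxy' : (y.1 : ℕ) ≤ x.1 := hxy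
        rw [if_neg (by omega)] at this
        rw [show F x y = 0 from this, map_zero]
    rw [this]
    split_ifs <;> simp
  have hGJ : G.map c = J * Gν.map c := by
    ext x q
    rw [Matrix.mul_apply]
    by_cases hx : (x.1 : ℕ) + 1 = ν
    · rw [hJlast x hx (fun p => Gν.map c p q)]
      simp only [Matrix.map_apply]
      congr 1
      exact h.input_last x.1 x.2 _ q hx rfl
    · rw [Matrix.map_apply, show G x q = 0 from h.input_zero x.1 x.2 q (hlt x hx), map_zero]
      exact (Finset.sum_eq_zero fun p _ => by rw [hJnot x p hx, zero_mul]).symm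
  have hCQ : H * Q = s ^ (1 - (ν : ℤ)) •
      ((outputPolynomial C Ninv).submatrix i id).map (algebraMap ℝ[X] (RatFunc ℝ)) := by
    ext p q
    rw [Matrix.mul_apply, Fintype.sum_sigma]
    simp only [Matrix.smul_apply, Matrix.map_apply, Matrix.submatrix_apply, outputPolynomial,
      Matrix.sum_apply, map_sum, smul_eq_mul, Finset.mul_sum, map_mul, map_pow, id]
    refine Finset.sum_congr rfl fun k _ => ?_
    rw [RatFunc.algebraMap_X, hc, Matrix.mul_apply, map_sum, Finset.mul_sum, Finset.mul_sum]
    refine Finset.sum_congr rfl fun a _ => ?_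
    simp only [H, Q, Matrix.submatrix_apply, Matrix.map_apply, Matrix.of_apply, id, outputBlock,
      map_mul]
    have : s ^ ((k : ℤ) + 1 - ν) = s ^ (1 - (ν : ℤ)) * s ^ (k : ℕ) := by
      rw [← zpow_natCast, ← zpow_add₀ hs]
      congr 1
      ring
    rw [this]
    ring
  have hg : (Gν.map c).det = RatFunc.C Gν.det := by
    rw [← RingHom.mapMatrix_apply]
    exact (RingHom.map_det c Gν).symm
  have hmain := det_fromBlocks_zero_feedback s hs D D₀ J R (Gν.map c) H Q rfl hQ (by
    rw [hg, h.det_eq_one, map_one]; exact one_ne_zero)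
  have hsys : algebraMap ℝ[X] (RatFunc ℝ) (systemMinor F G (C * Ninv) i
      (RelEmbedding.refl (· ≤ ·))) = (Matrix.fromBlocks D (-(J * Gν.map c)) H 0).det := by
    rw [systemMinor, RingHom.map_det]
    congr 1
    ext (x | x) (y | y)
    · simp [systemMatrix, D, Matrix.charmatrix_apply, Matrix.one_apply, Matrix.diagonal_apply, hc,
        apply_ite (algebraMap ℝ[X] (RatFunc ℝ)), s]
    · rw [← hGJ]
      simp [systemMatrix, hc]
    · simp only [systemMatrix, Matrix.submatrix_apply, RingHom.mapMatrix_apply, Matrix.map_apply,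
        Sum.map_inr, Sum.map_inl, Matrix.fromBlocks_apply₂₁, hc, H, id]
    · simp [systemMatrix]
  rw [hsys]
  rw [hdet, hCQ, Matrix.det_smul, hg, Fintype.card_fin] at hmain
  have hsr : s ^ r ≠ 0 := pow_ne_zero _ hs
  rw [← mul_left_inj' hsr, hmain, scaledMinor, RingHom.map_det (algebraMap ℝ[X] (RatFunc ℝ))]
  have : s ^ n * (s ^ (1 - (ν : ℤ))) ^ r = s ^ ((n : ℤ) - r * ν) * s ^ r := by
    rw [← zpow_natCast, ← zpow_natCast, ← zpow_natCast, ← zpow_mul, ← zpow_add₀ hs,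
      ← zpow_add₀ hs]
    congr 1
    ring
  calc _ = (s ^ n * (s ^ (1 - (ν : ℤ))) ^ r) * (((outputPolynomial C Ninv).submatrix i id).map
      (algebraMap ℝ[X] (RatFunc ℝ))).det * RatFunc.C Gν.det := by ring
    _ = _ := by
      rw [this]
      simp only [RingHom.mapMatrix_apply, s, ν]
      ring

end Minor

/-! ### Minors of the original system and the system zeros. -/

theorem polyGcd_eq_of_associated {S T : Set ℝ[X]} (h₁ : ∀ p ∈ S, ∃ q ∈ T, Associated p q)
    (h₂ : ∀ q ∈ T, ∃ p ∈ S, Associated p q) : polyGcd S = polyGcd T := by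
  refine dvd_antisymm_of_normalize_eq (normalize_idem _) (normalize_idem _) ?_ ?_
  · refine dvd_polyGcd fun q hq => ?_
    obtain ⟨p, hp, hpq⟩ := h₂ q hq
    exact (polyGcd_dvd hp).trans hpq.dvd
  · refine dvd_polyGcd fun p hp => ?_
    obtain ⟨q, hq, hpq⟩ := h₁ p hp
    exact (polyGcd_dvd hq).trans hpq.symm.dvd

/-- Minors of order `n + r` use all input columns, so only the output rows vary. -/
theorem orderEmbedding_fin_eq_refl {r : ℕ} (j : Fin r ↪o Fin r) :
    j = RelEmbedding.refl (· ≤ ·) := by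
  have h := Subsingleton.elim (RelIso.ofSurjective j (Finite.injective_iff_surjective.1 j.injective))
    (RelIso.refl _)
  ext x
  exact congrArg (fun e : Fin r ≃o Fin r => ((e x : Fin r) : ℕ)) h

/-- A maximal independent family of rows has `r` members; they are listed in increasing order. -/
theorem Matrix.exists_orderEmbedding_det_ne_zero {K : Type*} [Field K] {l r : ℕ}
    (H : Matrix (Fin l) (Fin r) K) (hH : H.rank = r) :
    ∃ i : Fin r ↪o Fin l, (H.submatrix i id).det ≠ 0 := by
  classical
  obtain ⟨κ, a, ha, hsp, hli⟩ := exists_linearIndependent' K H.row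
  have : Fintype κ := Fintype.ofInjective a ha
  have hcard : Fintype.card κ = r := by
    rw [← finrank_span_eq_card hli, hsp, ← Matrix.rank_eq_finrank_span_row, hH]
  let t : Finset (Fin l) := Finset.univ.image a
  have ht : t.card = r := by
    rw [Finset.card_image_of_injective _ ha, Finset.card_univ, hcard]
  refine ⟨t.orderEmbOfFin ht, ?_⟩
  rw [← isUnit_iff_ne_zero, ← Matrix.isUnit_iff_isUnit_det,
    ← Matrix.linearIndependent_rows_iff_isUnit]
  have hmem : ∀ p, ∃ k, a k = t.orderEmbOfFin ht p := fun p => by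
    obtain ⟨k, -, hk⟩ := Finset.mem_image.1 (Finset.orderEmbOfFin_mem t ht p)
    exact ⟨k, hk⟩
  choose b hb using hmem
  have hbi : Function.Injective b := fun p q hpq =>
    (t.orderEmbOfFin ht).injective (by rw [← hb, ← hb, hpq])
  have hrow : (H.submatrix (t.orderEmbOfFin ht) id).row = (H.row ∘ a) ∘ b := by
    ext p q
    simp [hb]
  rw [hrow]
  exact hli.comp b hbi

theorem systemMinor_eq_det_fromBlocks {ι : Type*} [Fintype ι] [DecidableEq ι] {r l k : ℕ}
    (A : Matrix ι ι ℝ) (B : Matrix ι (Fin r) ℝ) (C : Matrix (Fin l) ι ℝ)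
    (i : Fin k ↪o Fin l) (j : Fin k ↪o Fin r) :
    systemMinor A B C i j = (Matrix.fromBlocks A.charmatrix
      (-(B.submatrix id j).map Polynomial.C) ((C.submatrix i id).map Polynomial.C) 0).det := by
  rw [systemMinor, systemMatrix]
  congr 1
  ext (x | x) (y | y) <;> simp

theorem systemMinor_conj {ι κ : Type*} [Fintype ι] [DecidableEq ι] [Fintype κ] [DecidableEq κ]
    {r l : ℕ} (A : Matrix κ κ ℝ) (B : Matrix κ (Fin r) ℝ) (C : Matrix (Fin l) κ ℝ)
    {N : Matrix ι κ ℝ} {Ninv : Matrix κ ι ℝ} (h₁ : N * Ninv = 1) (h₂ : Ninv * N = 1)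
    (V : Matrix (Fin r) (Fin r) ℝ) (i : Fin r ↪o Fin l) :
    systemMinor (N * A * Ninv) (N * B * V) (C * Ninv) i (RelEmbedding.refl (· ≤ ·)) =
      systemMinor A B C i (RelEmbedding.refl (· ≤ ·)) * Polynomial.C V.det := by
  simp only [systemMinor_eq_det_fromBlocks]
  have hid : ⇑(RelEmbedding.refl (· ≤ · : Fin r → Fin r → Prop)) = id := rfl
  simp only [hid, Matrix.submatrix_id_id]
  let c : ℝ →+* ℝ[X] := Polynomial.C
  have h₁' : N.map c * Ninv.map c = 1 := by
    rw [← Matrix.map_mul, h₁, Matrix.map_one _ (map_zero c) (map_one c)]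
  have h₂' : Ninv.map c * N.map c = 1 := by
    rw [← Matrix.map_mul, h₂, Matrix.map_one _ (map_zero c) (map_one c)]
  have e : Matrix.fromBlocks (N * A * Ninv).charmatrix (-(N * B * V).map c)
      (((C * Ninv).submatrix i id).map c) 0 =
      Matrix.fromBlocks (N.map c) 0 0 (1 : Matrix (Fin r) (Fin r) ℝ[X]) *
        (Matrix.fromBlocks A.charmatrix (-B.map c) ((C.submatrix i id).map c) 0 *
          Matrix.fromBlocks 1 0 0 (V.map c)) *
          Matrix.fromBlocks (Ninv.map c) 0 0 (1 : Matrix (Fin r) (Fin r) ℝ[X]) := by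
    simp only [Matrix.fromBlocks_multiply]
    congr 1
    · simp only [Matrix.mul_zero, Matrix.zero_mul, Matrix.mul_one, add_zero, Matrix.charmatrix,
        Matrix.mul_sub, Matrix.sub_mul, RingHom.mapMatrix_apply]
      rw [Matrix.scalar_apply, Matrix.scalar_apply, ← Matrix.smul_one_eq_diagonal,
        ← Matrix.smul_one_eq_diagonal, Matrix.mul_smul, Matrix.mul_one, Matrix.smul_mul, h₁']
      simp [c]
    · simp [Matrix.mul_assoc, c]
    · rw [show (C * Ninv).submatrix i id = C.submatrix i id * Ninv from rfl]
      simp [c]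
    · simp
  change (Matrix.fromBlocks (N * A * Ninv).charmatrix (-(N * B * V).map c)
      (((C * Ninv).submatrix i id).map c) 0).det = _
  rw [e, Matrix.det_conj_of_mul_eq_one, Matrix.det_mul, Matrix.det_fromBlocks_zero₂₁,
    Matrix.det_one, one_mul, ← RingHom.mapMatrix_apply c V, ← RingHom.map_det]
  · simp [Matrix.fromBlocks_multiply, h₁', Matrix.fromBlocks_one]
  · simp [Matrix.fromBlocks_multiply, h₂', Matrix.fromBlocks_one]

/-- Over `ℝ(s)` the block `sI - A` is invertible, so the minors in question are `det (sI - A)` times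
the minors of order `r` of the transfer matrix `C (sI - A)⁻¹ B`. It is enough that this Schur
complement has rank `r`. -/
theorem exists_systemMinor_ne_zero {n r l : ℕ} (A : Matrix (Fin n) (Fin n) ℝ)
    (B : Matrix (Fin n) (Fin r) ℝ) (C : Matrix (Fin l) (Fin n) ℝ)
    (h : normalRank (systemMatrix A B C) = n + r) :
    ∃ i : Fin r ↪o Fin l, systemMinor A B C i (RelEmbedding.refl (· ≤ ·)) ≠ 0 := by
  let φ := algebraMap ℝ[X] (RatFunc ℝ)
  let D := A.charmatrix.map φ
  let E := (B.map Polynomial.C).map φ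
  let G := (C.map Polynomial.C).map φ
  have hmap : (systemMatrix A B C).map φ = Matrix.fromBlocks D (-E) G 0 := by
    ext (x | x) (y | y) <;> simp [systemMatrix, D, E, G]
  have hDdet : D.det ≠ 0 := by
    have : D.det = φ A.charpoly := by
      rw [Matrix.charpoly, RingHom.map_det]; rfl
    rw [this, map_ne_zero_iff _ (RatFunc.algebraMap_injective ℝ)]
    exact A.charpoly_monic.ne_zero
  have hDu : IsUnit D.det := isUnit_iff_ne_zero.2 hDdet
  have hinv : Invertible D := D.invertibleOfIsUnitDet hDu
  have hinj : Function.Injective (Matrix.fromBlocks D (-E) G 0).mulVec := by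
    rw [Matrix.mulVec_injective_iff, linearIndependent_iff_card_eq_finrank_span,
      Set.finrank, ← Matrix.rank_eq_finrank_span_cols, ← hmap]
    simpa [normalRank] using h.symm
  have hrank : (G * D⁻¹ * E).rank = r := by
    have hcol : LinearIndependent (RatFunc ℝ) (G * D⁻¹ * E).col := by
      rw [← Matrix.mulVec_injective_iff]
      intro y z hyz
      have hyz : (G * D⁻¹ * E).mulVec (y - z) = 0 := by
        rw [Matrix.mulVec_sub]; exact sub_eq_zero.2 hyz
      -- A kernel vector `w` of the transfer matrix lifts to the kernel vector `(D⁻¹ E w, w)` of the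
      -- system matrix, whose columns are independent.
      have h0 : (Matrix.fromBlocks D (-E) G 0).mulVec
          (Sum.elim ((D⁻¹ * E).mulVec (y - z)) (y - z)) = 0 := by
        rw [Matrix.fromBlocks_mulVec]
        ext (x | x)
        · simp [Matrix.mulVec_mulVec, ← Matrix.mul_assoc, Matrix.mul_nonsing_inv _ hDu,
            Matrix.neg_mulVec]
        · simp [Matrix.mulVec_mulVec, ← Matrix.mul_assoc, hyz]
      have := hinj (h0.trans (Matrix.mulVec_zero _).symm)
      have := fun q => congrFun this (Sum.inr q)
      ext q
      simpa [sub_eq_zero] using this q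
    rw [Matrix.rank_eq_finrank_span_cols, finrank_span_eq_card hcol, Fintype.card_fin]
  obtain ⟨i, hi⟩ := Matrix.exists_orderEmbedding_det_ne_zero _ hrank
  refine ⟨i, fun h0 => hi ?_⟩
  rw [systemMinor_eq_det_fromBlocks] at h0
  have h1 := congrArg φ h0
  rw [RingHom.map_det, RingHom.mapMatrix_apply, Matrix.fromBlocks_map, map_zero] at h1
  have h2 : (Matrix.fromBlocks D (-E) (G.submatrix i id) 0).det = 0 := by
    rw [← h1]
    congr 1
    ext (x | x) (y | y) <;> simp [D, E, G]
  rw [Matrix.det_fromBlocks₁₁] at h2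
  have h3 := (mul_eq_zero.1 h2).resolve_left hDdet
  rw [← h3]
  congr 1
  simp only [Matrix.invOf_eq_nonsing_inv, Matrix.mul_neg, sub_neg_eq_add, zero_add]
  rfl

theorem maxMinorOrder_eq {n r l : ℕ} {A : Matrix (Fin n) (Fin n) ℝ}
    {B : Matrix (Fin n) (Fin r) ℝ} {C : Matrix (Fin l) (Fin n) ℝ}
    (h : ∃ i : Fin r ↪o Fin l, systemMinor A B C i (RelEmbedding.refl (· ≤ ·)) ≠ 0) :
    maxMinorOrder A B C = r := by
  obtain ⟨i, hi⟩ := h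
  refine IsGreatest.csSup_eq ⟨⟨i, _, hi⟩, ?_⟩
  rintro k ⟨-, j, -⟩
  simpa using Fintype.card_le_of_injective j j.injective

theorem systemZeros_eq_zeros_outputGcd {n r l : ℕ} {A : Matrix (Fin n) (Fin n) ℝ}
    {B : Matrix (Fin n) (Fin r) ℝ} {N : Matrix (BlockIndex A B) (Fin n) ℝ}
    {Ninv : Matrix (Fin n) (BlockIndex A B) ℝ} {M : Equiv.Perm (Fin r)}
    {Gν : Matrix (Fin r) (Fin r) ℝ} (h : IsYokoyama A B N Ninv M Gν) (hb : BlockSizeSpec A B)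
    (C : Matrix (Fin l) (Fin n) ℝ) (hr : normalRank (systemMatrix A B C) = n + r) :
    outputGcd C Ninv ≠ 0 ∧ systemZeros A B C = zeros (outputGcd C Ninv) := by
  obtain ⟨i₀, hi₀⟩ := exists_systemMinor_ne_zero A B C hr
  let d : ℝ := (M.permMatrix ℝ).det
  have hd : IsUnit (Polynomial.C d) := by
    rw [Polynomial.isUnit_C, isUnit_iff_ne_zero]
    simp [d, Matrix.det_permutation]
  have key : ∀ (i : Fin r ↪o Fin l), algebraMap ℝ[X] (RatFunc ℝ)
      (systemMinor A B C i (RelEmbedding.refl (· ≤ ·)) * Polynomial.C d) =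
      scaledMinor C Ninv i := by
    intro i
    have := h.systemMinor_eq hb C i
    rwa [systemMinor_conj A B C h.mul_inv h.inv_mul, h.det_eq_one, map_one, mul_one] at this
  have hassoc : ∀ p : ℝ[X], Associated p (p * Polynomial.C d) := fun p =>
    (associated_mul_unit_right p _ hd)
  constructor
  · intro h0
    refine mul_ne_zero hi₀ hd.ne_zero (zero_dvd_iff.1 ?_)
    rw [← h0]
    exact polyGcd_dvd ⟨mul_ne_zero hi₀ hd.ne_zero, i₀, key i₀⟩
  · rw [systemZeros, maxMinorOrder_eq ⟨i₀, hi₀⟩, outputGcd]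
    congr 1
    apply polyGcd_eq_of_associated
    · rintro p ⟨hp, i, j, rfl⟩
      rw [orderEmbedding_fin_eq_refl j] at hp ⊢
      exact ⟨_, ⟨mul_ne_zero hp hd.ne_zero, i, key i⟩, hassoc _⟩
    · rintro q ⟨hq, i, hi⟩
      have : q = systemMinor A B C i (RelEmbedding.refl (· ≤ ·)) * Polynomial.C d :=
        RatFunc.algebraMap_injective ℝ (hi.trans (key i).symm)
      subst this
      exact ⟨_, ⟨left_ne_zero_of_mul hq, i, _, rfl⟩, hassoc _⟩

/-! ### Existence of a Yokoyama reduction. -/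

section Existence

variable {n r : ℕ} {A : Matrix (Fin n) (Fin n) ℝ} {B : Matrix (Fin n) (Fin r) ℝ}

theorem rank_krylovMatrix_ctrlIndex (hK : (krylovMatrix A B n).rank = n) :
    (krylovMatrix A B (ctrlIndex A B)).rank = n := by
  have : ctrlIndex A B ∈ {k : ℕ | (krylovMatrix A B n).rank = (krylovMatrix A B k).rank} :=
    Nat.sInf_mem ⟨n, rfl⟩
  exact this.symm.trans hK

theorem rank_krylovMatrix_le (k : ℕ) : (krylovMatrix A B k).rank ≤ n := by
  exact (Matrix.rank_le_card_height _).trans_eq (Fintype.card_fin n)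

namespace IsKrylovSelection

variable {μ : Fin r → ℕ}

theorem blockSize_eq (h : IsKrylovSelection A B μ)
    (i : Fin (ctrlIndex A B)) :
    blockSize A B i = (Finset.univ.filter fun j => ctrlIndex A B < μ j + (i + 1)).card := by
  rw [blockSize, show ctrlIndex A B - i = ctrlIndex A B - (i + 1) + 1 by omega,
    h.rank_krylovMatrix, h.rank_krylovMatrix, Finset.sum_range_succ, Nat.add_sub_cancel_left]
  congr 1
  ext j
  simp
  omega

/-- The rank is already `n` at `ν`; a longer chain would raise it further. -/
theorem le_ctrlIndex (h : IsKrylovSelection A B μ)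
    (hK : (krylovMatrix A B n).rank = n) (j : Fin r) : μ j ≤ ctrlIndex A B := by
  by_contra hlt
  have h1 := h.rank_krylovMatrix (ctrlIndex A B + 1)
  rw [Finset.sum_range_succ, ← h.rank_krylovMatrix, rank_krylovMatrix_ctrlIndex hK] at h1
  have h2 := rank_krylovMatrix_le (A := A) (B := B) (ctrlIndex A B + 1)
  have h3 : 0 < (Finset.univ.filter fun j => ctrlIndex A B < μ j).card :=
    Finset.card_pos.2 ⟨j, by simpa using hlt⟩
  omega

theorem pos (h : IsKrylovSelection A B μ)
    (hB : B.rank = r) (j : Fin r) : 0 < μ j := by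
  have h1 : (krylovMatrix A B 1).rank = r := by
    have hcol : Set.range (krylovMatrix A B 1).col = Set.range B.col := by
      ext v
      constructor
      · rintro ⟨⟨i, j⟩, rfl⟩
        refine ⟨j, ?_⟩
        ext x
        simp [krylovMatrix, show i = 0 from Subsingleton.elim _ _]
      · rintro ⟨j, rfl⟩
        refine ⟨(0, j), ?_⟩
        ext x
        simp [krylovMatrix]
    refine Eq.trans ?_ hB
    rw [Matrix.rank_eq_finrank_span_cols, hcol, ← Matrix.rank_eq_finrank_span_cols]
  have h2 := h.rank_krylovMatrix 1
  rw [h1, Finset.sum_range_one] at h2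
  have h3 : (Finset.univ.filter fun j => 0 < μ j) = Finset.univ := by
    apply Finset.eq_univ_of_card
    simp [← h2]
  have := Finset.mem_univ j
  rw [← h3] at this
  simpa using this

theorem blockSizeSpec (h : IsKrylovSelection A B μ)
    (hK : (krylovMatrix A B n).rank = n) (hB : B.rank = r) :
    BlockSizeSpec A B where
  mono i j hij := by
    rw [h.blockSize_eq, h.blockSize_eq]
    refine Finset.card_le_card fun p hp => ?_
    simp at hp ⊢
    omega
  last i hi := by
    rw [h.blockSize_eq, Finset.filter_true_of_mem]
    · simp
    · intro j _
      have := h.pos hB j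
      omega
  le i := by
    rw [h.blockSize_eq]
    simpa using Finset.card_filter_le (Finset.univ : Finset (Fin r)) _
  sum := by
    have h1 := h.rank_krylovMatrix (ctrlIndex A B)
    rw [rank_krylovMatrix_ctrlIndex hK, ← Finset.sum_range_reflect, Finset.sum_range] at h1
    refine Eq.trans (Finset.sum_congr rfl fun i _ => ?_) h1.symm
    rw [h.blockSize_eq]
    congr 1
    ext j
    simp
    omega

/-- A Krylov selection gives a basis of the state space; `φ j` is the functional of the dual basis
belonging to the last vector of the chain `j`. -/
theorem exists_dual (h : IsKrylovSelection A B μ)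
    (hK : (krylovMatrix A B n).rank = n) :
    (∀ v : Fin n → ℝ, ∃ x : ℕ × Fin r → ℝ, v = ∑ j, ∑ t ∈ Finset.range (μ j),
        x (t, j) • krylovVec A B (t, j)) ∧
      ∃ φ : Fin r → (Fin n → ℝ) →ₗ[ℝ] ℝ, ∀ j k j', k < μ j' →
        φ j (krylovVec A B (k, j')) = if j' = j ∧ k + 1 = μ j then 1 else 0 := by
  classical
  have htop : ⊤ ≤ Submodule.span ℝ (Set.range
      fun x : {x : ℕ × Fin r | x.1 < μ x.2} => krylovVec A B x) := by
    have h1 : Submodule.span ℝ (krylovVec A B '' {x | x.1 < n}) = ⊤ := by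
      apply Submodule.eq_top_of_finrank_eq
      rw [← _root_.rank_krylovMatrix, hK]
      simp
    rw [← h1, Submodule.span_le, ← Set.image_eq_range]
    rintro _ ⟨⟨k, j⟩, -, rfl⟩
    exact Submodule.span_mono (Set.image_mono fun x hx => hx.2) (h.span k j)
  let b := Module.Basis.mk h.indep htop
  constructor
  · intro v
    have hv : v ∈ Submodule.span ℝ (krylovVec A B '' {x | x.1 < μ x.2}) := by
      rw [Set.image_eq_range]; exact htop trivial
    let s : Finset (ℕ × Fin r) := (Finset.univ : Finset (Fin r)).biUnion fun j =>
      Finset.range (μ j) ×ˢ {j}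
    have hs : {x : ℕ × Fin r | x.1 < μ x.2} = (s : Set (ℕ × Fin r)) := by
      ext ⟨t, j⟩
      simp [s]
    rw [hs, Submodule.mem_span_image_finset_iff_exists_fun'] at hv
    obtain ⟨x, rfl⟩ := hv
    refine ⟨x, ?_⟩
    rw [Finset.sum_biUnion]
    · simp only [Finset.sum_product, Finset.sum_singleton]
    · intro i _ j _ hij
      rw [Function.onFun, Finset.disjoint_left]
      rintro ⟨t, j'⟩ h1 h2
      simp at h1 h2
      exact hij (h1.2.trans h2.2.symm)
  · refine ⟨fun j => if hj : 0 < μ j then b.coord ⟨(μ j - 1, j), by simpa using hj⟩ else 0, ?_⟩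
    intro j k j' hk
    have hbk : krylovVec A B (k, j') = b ⟨(k, j'), hk⟩ :=
      (Module.Basis.mk_apply h.indep htop ⟨(k, j'), hk⟩).symm
    by_cases hj : 0 < μ j
    · simp only [dif_pos hj]
      rw [hbk, Module.Basis.coord_apply, Module.Basis.repr_self, Finsupp.single_apply]
      refine if_congr ?_ rfl rfl
      simp only [Subtype.mk.injEq, Prod.mk.injEq]
      rw [and_comm]
      exact and_congr_right fun _ => by omega
    · simp only [dif_neg hj]
      rw [if_neg (by omega), LinearMap.zero_apply]

variable {φ : Fin r → (Fin n → ℝ) →ₗ[ℝ] ℝ}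

/-- `A ^ k b_j'` is a combination of basis vectors with exponent at most `k`, and the last vector of
chain `j` has exponent `μ j - 1 > k`. This makes the upper block rows of `G` vanish. -/
theorem dual_eq_zero (h : IsKrylovSelection A B μ)
    (hφ : ∀ j k j', k < μ j' →
      φ j (krylovVec A B (k, j')) = if j' = j ∧ k + 1 = μ j then 1 else 0)
    {j : Fin r} {k : ℕ} (hk : k + 1 < μ j) (j' : Fin r) :
    φ j (krylovVec A B (k, j')) = 0 := by
  have hle : Submodule.span ℝ (krylovVec A B '' {x | x.1 ≤ k ∧ x.1 < μ x.2}) ≤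
      LinearMap.ker (φ j) := by
    rw [Submodule.span_le]
    rintro _ ⟨⟨k', j''⟩, ⟨h1, h2⟩, rfl⟩
    simp only at h1 h2
    simp only [SetLike.mem_coe, LinearMap.mem_ker]
    rw [hφ j k' j'' h2, if_neg (by omega)]
  exact hle (h.span k j')

/-- Injectivity of `N`. Expanding `v` in the chain basis gives a triangular system, solved by
induction on the distance `k` to the end of the chain. -/
theorem eq_zero_of_dual_pow (h : IsKrylovSelection A B μ)
    (hφ : ∀ j k j', k < μ j' →
      φ j (krylovVec A B (k, j')) = if j' = j ∧ k + 1 = μ j then 1 else 0)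
    (hK : (krylovMatrix A B n).rank = n) {v : Fin n → ℝ}
    (hv : ∀ j k, k < μ j → φ j ((A ^ k).mulVec v) = 0) : v = 0 := by
  obtain ⟨x, rfl⟩ := (h.exists_dual hK).1 v
  have key : ∀ k j, k < μ j → x (μ j - 1 - k, j) = 0 := by
    intro k
    induction k using Nat.strong_induction_on with
    | _ k ih =>
      intro j hk
      have := hv j k hk
      simp only [Matrix.mulVec_sum, Matrix.mulVec_smul, pow_mulVec_krylovVec, map_sum, map_smul,
        smul_eq_mul] at this
      rw [Finset.sum_eq_single j, Finset.sum_eq_single (μ j - 1 - k)] at this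
      · rw [hφ j _ j (by omega), if_pos ⟨rfl, by omega⟩, mul_one] at this
        exact this
      · intro t ht htk
        rw [Finset.mem_range] at ht
        by_cases hlt : k + t < μ j
        · rw [hφ j _ j hlt, if_neg (by omega), mul_zero]
        -- If `A ^ k` pushes a vector beyond the end of its chain, that vector is closer than `k` to
        -- the end, and its coefficient is already known to be zero.
        · have := ih (μ j - 1 - t) (by omega) j (by omega)
          rw [show μ j - 1 - (μ j - 1 - t) = t by omega] at this
          rw [this, zero_mul]
      · intro hnot
        rw [Finset.mem_range] at hnot
        omega
      · intro j' _ hj'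
        refine Finset.sum_eq_zero fun t ht => ?_
        rw [Finset.mem_range] at ht
        by_cases hlt : k + t < μ j'
        · rw [hφ j _ j' hlt, if_neg (fun hh => hj' hh.1), mul_zero]
        · have := ih (μ j' - 1 - t) (by omega) j' (by omega)
          rw [show μ j' - 1 - (μ j' - 1 - t) = t by omega] at this
          rw [this, zero_mul]
      · simp
  refine Finset.sum_eq_zero fun j _ => Finset.sum_eq_zero fun t ht => ?_
  rw [Finset.mem_range] at ht
  have := key (μ j - 1 - t) j (by omega)
  rw [show μ j - 1 - (μ j - 1 - t) = t by omega] at this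
  rw [this, zero_smul]

end IsKrylovSelection

/-- For a monotone `ρ`, the set `{p | k < ρ p}` consists of the last indices. -/
theorem lt_iff_le_add_card_filter {ρ : Fin r → ℕ} (hρ : Monotone ρ) (k : ℕ) (p : Fin r) :
    k < ρ p ↔ r ≤ p + (Finset.univ.filter fun q => k < ρ q).card := by
  constructor
  · intro hk
    have : Finset.Ici p ⊆ Finset.univ.filter fun q => k < ρ q := by
      intro q hq
      simp at hq ⊢
      exact hk.trans_le (hρ hq)
    have := Finset.card_le_card this
    rw [Fin.card_Ici] at this
    omega
  · intro hr
    by_contra hk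
    have : (Finset.univ.filter fun q => k < ρ q) ⊆ Finset.Ioi p := by
      intro q hq
      simp at hq ⊢
      by_contra hqp
      have := hρ (not_lt.1 hqp)
      omega
    have := Finset.card_le_card this
    rw [Fin.card_Ioi] at this
    have := p.2
    omega

theorem Matrix.exists_two_sided_inverse {ι κ K : Type*} [Field K] [Fintype ι] [DecidableEq ι]
    [Fintype κ] [DecidableEq κ] (N : Matrix ι κ K) (hcard : Fintype.card ι = Fintype.card κ)
    (hN : ∀ v, N.mulVec v = 0 → v = 0) : ∃ N' : Matrix κ ι K, N * N' = 1 ∧ N' * N = 1 := by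
  let e : ι ≃ κ := Fintype.equivOfCardEq hcard
  let N₀ : Matrix κ κ K := N.submatrix e.symm id
  have hu : IsUnit N₀ := by
    rw [← Matrix.mulVec_injective_iff_isUnit]
    intro v w hvw
    rw [← sub_eq_zero]
    apply hN
    have : N₀.mulVec (v - w) = 0 := by rw [Matrix.mulVec_sub]; exact sub_eq_zero.2 hvw
    ext x
    simpa [N₀, Matrix.mulVec] using congrFun this (e x)
  rw [Matrix.isUnit_iff_isUnit_det] at hu
  have h2 : (N₀⁻¹.submatrix id e) * N = 1 := by
    have : N = N₀.submatrix e id := by ext; simp [N₀]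
    rw [this, Matrix.submatrix_mul_equiv, Matrix.nonsing_inv_mul _ hu]
    simp
  have h1 : N * (N₀⁻¹.submatrix id e) = 1 := by
    have : N = N₀.submatrix e id := by ext; simp [N₀]
    rw [this, ← Matrix.submatrix_mul _ _ _ _ _ Function.bijective_id, Matrix.mul_nonsing_inv _ hu,
      Matrix.submatrix_one_equiv]
  exact ⟨_, h1, h2⟩

theorem exists_isYokoyama (hK : (krylovMatrix A B n).rank = n) (hB : B.rank = r) :
    ∃ (N : Matrix (BlockIndex A B) (Fin n) ℝ) (Ninv : Matrix (Fin n) (BlockIndex A B) ℝ)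
      (M : Equiv.Perm (Fin r)) (Gν : Matrix (Fin r) (Fin r) ℝ), IsYokoyama A B N Ninv M Gν := by
  classical
  obtain ⟨μ, h⟩ := exists_isKrylovSelection A B hK
  obtain ⟨φ, hφ⟩ := (h.exists_dual hK).2
  have hb := h.blockSizeSpec hK hB
  set ν := ctrlIndex A B
  let σ : Equiv.Perm (Fin r) := Tuple.sort μ
  let ρ : Fin r → ℕ := μ ∘ σ
  have hρ : Monotone ρ := Tuple.monotone_sort μ
  have hρpos : ∀ p, 0 < ρ p := fun p => h.pos hB _
  have hρle : ∀ p, ρ p ≤ ν := fun p => h.le_ctrlIndex hK _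
  -- With the chains sorted by length, those that reach block `i` are exactly the last `l_i`.
  have hcut : ∀ (i : Fin ν) (p : Fin r), ν < ρ p + (i + 1) ↔ r ≤ p + blockSize A B i := by
    intro i p
    have h1 := lt_iff_le_add_card_filter hρ (ν - (i + 1)) p
    have h2 : (Finset.univ.filter fun q => ν - (i + 1) < ρ q).card = blockSize A B i := by
      rw [h.blockSize_eq]
      refine Finset.card_bij (fun q _ => σ q) ?_ (fun _ _ _ _ hh => σ.injective hh) ?_
      · intro q hq
        simp [ρ] at hq ⊢
        omega
      · intro q hq
        refine ⟨σ.symm q, ?_, by simp⟩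
        simp [ρ] at hq ⊢
        omega
    rw [h2] at h1
    rw [← h1]
    omega
  -- The sorted position of the chain that owns coordinate `x`: blocks are aligned at their right
  -- ends, as in `[O, I]`.
  let P : BlockIndex A B → Fin r := fun x =>
    ⟨x.2 + (r - blockSize A B x.1), by have := hb.le x.1; have := x.2.2; omega⟩
  have hP : ∀ x, ((P x : Fin r) : ℕ) = x.2 + (r - blockSize A B x.1) := fun x => rfl
  have hPρ : ∀ x : BlockIndex A B, ν < ρ (P x) + (x.1 + 1) := fun x => by
    rw [hcut, hP]
    have := hb.le x.1
    omega
  let row : Fin r → ℕ → Fin n → ℝ := fun p e y => φ (σ p) ((A ^ e).mulVec (Pi.single y 1))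
  have hrow : ∀ p e (v : Fin n → ℝ), ∑ y, row p e y * v y = φ (σ p) ((A ^ e).mulVec v) := by
    intro p e v
    have : v = ∑ y, v y • Pi.single (M := fun _ => ℝ) y 1 := pi_eq_sum_univ' v
    conv_rhs => rw [this, Matrix.mulVec_sum, map_sum]
    refine Finset.sum_congr rfl fun y _ => ?_
    rw [Matrix.mulVec_smul, map_smul, smul_eq_mul, mul_comm]
  -- The exponent is `ρ - 1` in the last block and drops by one per block upwards; by `hPρ` the
  -- subtraction does not truncate.
  let N : Matrix (BlockIndex A B) (Fin n) ℝ := Matrix.of fun x => row (P x) (ρ (P x) + x.1 - ν)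
  have hNv : ∀ v x, N.mulVec v x = φ (σ (P x)) ((A ^ (ρ (P x) + x.1 - ν)).mulVec v) :=
    fun v x => hrow _ _ _
  obtain ⟨Ninv, h1, h2⟩ := Matrix.exists_two_sided_inverse N (by
    rw [Fintype.card_sigma, Fintype.card_fin]
    simpa using hb.sum) (by
    intro v hv
    refine h.eq_zero_of_dual_pow hφ hK fun j k hk => ?_
    have hk' : k < ρ (σ.symm j) := by simpa [ρ] using hk
    have hle := hρle (σ.symm j)
    -- The block in which the row of chain `j` has exponent exactly `k`.
    let i : Fin ν := ⟨k + ν - ρ (σ.symm j), by omega⟩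
    have hi : (i : ℕ) = k + ν - ρ (σ.symm j) := rfl
    have hc := (hcut i (σ.symm j)).1 (by omega)
    have := hb.le i
    have := (σ.symm j).2
    let x : BlockIndex A B := ⟨i, ⟨(σ.symm j : ℕ) + blockSize A B i - r, by omega⟩⟩
    have hPx : P x = σ.symm j := Fin.ext (by rw [hP]; simp only [x]; omega)
    have := congrFun hv x
    rw [hNv, hPx] at this
    have he : ρ (σ.symm j) + x.1 - ν = k := by simp only [x]; omega
    rw [he, Equiv.apply_symm_apply] at this
    exact this)
  have hNB : ∀ x q, (N * B * (σ⁻¹).permMatrix ℝ) x q =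
      φ (σ (P x)) (krylovVec A B (ρ (P x) + x.1 - ν, σ q)) := by
    intro x q
    have : (N * B * (σ⁻¹).permMatrix ℝ) x q = (N * B) x (σ q) := by
      rw [Equiv.Perm.permMatrix, PEquiv.mul_toMatrix_toPEquiv]
      rfl
    rw [this]
    have h3 := hNv (B.col (σ q)) x
    have h4 := pow_mulVec_krylovVec A B (ρ (P x) + x.1 - ν) 0 (σ q)
    rw [add_zero] at h4
    rw [← h4]
    simp only [krylovVec, pow_zero, Matrix.one_mul]
    exact h3
  let Gν : Matrix (Fin r) (Fin r) ℝ :=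
    Matrix.of fun p q => φ (σ p) (krylovVec A B (ρ p - 1, σ q))
  -- Here `A ^ (ρ p - 1)` does not leave the chain `σ q`, so the functional is evaluated on a basis
  -- vector.
  have hG : ∀ p q, ρ p ≤ ρ q → Gν p q = if p = q then 1 else 0 := by
    intro p q hpq
    have := hρpos p
    change φ (σ p) _ = _
    rw [hφ _ _ _ (show ρ p - 1 < ρ q by omega)]
    have : ρ p - 1 + 1 = μ (σ p) := by change _ = ρ p; omega
    simp [this, eq_comm]
  -- With Mathlib's convention it is the permutation matrix of `σ⁻¹` that brings column `σ q` to
  -- position `q`.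
  refine ⟨N, Ninv, σ⁻¹, Gν, h1, h2, ?_, ?_, ?_, ?_, ?_, ?_⟩
  · intro i j a b hi
    let k : Fin ν := ⟨i + 1, hi⟩
    have hm := hb.mono i k rfl
    have hkr := hb.le k
    let x : BlockIndex A B := ⟨i, a⟩
    let x' : BlockIndex A B := ⟨k, ⟨a + (blockSize A B k - blockSize A B i), by omega⟩⟩
    have hPx : P x' = P x := Fin.ext (by rw [hP, hP]; simp only [x, x']; omega)
    -- The same chain one block lower has one more factor `A`; hence this row of `N A N⁻¹` is the
    -- row `x'` of the unit matrix.
    have hNA : (N * A) x = N x' := by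
      ext y
      have h3 := hNv (A.col y) x
      have h4 : N x' y = N.mulVec (Pi.single y 1) x' := by simp
      rw [h4, hNv, hPx]
      refine h3.trans ?_
      have h5 : ρ (P x) + x'.1 - ν = (ρ (P x) + x.1 - ν) + 1 := by
        have := hPρ x
        simp only [x, x', k] at this ⊢
        omega
      rw [h5, pow_succ, ← Matrix.mulVec_mulVec, Matrix.mulVec_single_one]
    have h6 : (N * A * Ninv) x ⟨j, b⟩ = (N * Ninv) x' ⟨j, b⟩ := by
      rw [Matrix.mul_apply, Matrix.mul_apply]
      exact Finset.sum_congr rfl fun y _ => by rw [hNA]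
    rw [h6, h1, Matrix.one_apply]
    split_ifs with h7 h8 h8
    · rw [zeroUnit, Matrix.of_apply, if_pos]
      obtain ⟨rfl, h9⟩ := Sigma.mk.inj_iff.1 h7
      rw [heq_eq_eq] at h9
      rw [← h9]
      simp
      omega
    · exact absurd (congrArg (fun z : BlockIndex A B => (z.1 : ℕ)) h7).symm h8
    · obtain rfl : j = k := Fin.ext h8
      rw [zeroUnit, Matrix.of_apply, if_neg]
      intro h9
      apply h7
      simp only [x']
      congr 1
      ext
      simp
      omega
    · rfl
  · intro i a q hi
    rw [hNB]
    apply h.dual_eq_zero hφ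
    change _ < ρ (P ⟨i, a⟩)
    have := hPρ ⟨i, a⟩
    simp only at this ⊢
    omega
  · intro i a p q hi hap
    rw [hNB]
    have hl := hb.last i hi
    have hPp : P ⟨i, a⟩ = p := Fin.ext (by rw [hP]; simp only; omega)
    rw [hPp]
    have : ρ p + i - ν = ρ p - 1 := by omega
    simp only [this]
    rfl
  · intro p
    rw [hG p p le_rfl, if_pos rfl]
  · intro p q hpq
    rw [hG p q (hρ hpq.le), if_neg hpq.ne]
  · intro p q hqp hno
    rw [hG p q, if_neg hqp.ne']
    by_contra hlt
    have := hρle p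
    -- If `ρ q < ρ p`, the chain `p` reaches this block and the chain `q` just misses it, so its cut
    -- point separates `p` from `q`.
    let k : Fin ν := ⟨ν - (ρ q + 1), by omega⟩
    have hk : (k : ℕ) = ν - (ρ q + 1) := rfl
    have h3 := hcut k p
    have h4 := hcut k q
    have h5 := hno k
    omega

end Existence

/-! ### The theorem. -/

theorem theorem7p2 {n r l : ℕ} (A : Matrix (Fin n) (Fin n) ℝ) (B : Matrix (Fin n) (Fin r) ℝ)
    (C : Matrix (Fin l) (Fin n) ℝ) (hAB : IsControllable A B) (hB : B.rank = r) (hlr : r < l) :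
    (∃ (N : Matrix (BlockIndex A B) (Fin n) ℝ) (Ninv : Matrix (Fin n) (BlockIndex A B) ℝ)
      (M : Equiv.Perm (Fin r)) (Gν : Matrix (Fin r) (Fin r) ℝ), IsYokoyama A B N Ninv M Gν) ∧
    ∀ (N : Matrix (BlockIndex A B) (Fin n) ℝ) (Ninv : Matrix (Fin n) (BlockIndex A B) ℝ)
      (M : Equiv.Perm (Fin r)) (Gν : Matrix (Fin r) (Fin r) ℝ), IsYokoyama A B N Ninv M Gν →
      Gν.det ≠ 0 ∧
      (∀ i : Fin r ↪o Fin l,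
        (∃ p : ℝ[X], algebraMap ℝ[X] (RatFunc ℝ) p = scaledMinor C Ninv i) ∧
        algebraMap ℝ[X] (RatFunc ℝ)
            (systemMinor (N * A * Ninv) (N * B * M.permMatrix ℝ) (C * Ninv) i
              (RelEmbedding.refl (· ≤ ·))) =
          scaledMinor C Ninv i * RatFunc.C Gν.det) ∧
      (normalRank (systemMatrix A B C) = n + r →
        outputGcd C Ninv ≠ 0 ∧ systemZeros A B C = zeros (outputGcd C Ninv)) := by
  have hK := hAB.rank_krylovMatrix
  obtain ⟨μ, hμ⟩ := exists_isKrylovSelection A B hK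
  have hb := hμ.blockSizeSpec hK hB
  refine ⟨exists_isYokoyama hK hB, fun N Ninv M Gν h => ⟨?_, fun i => ⟨?_, ?_⟩, ?_⟩⟩
  · rw [h.det_eq_one]
    exact one_ne_zero
  -- The polynomial is the minor itself, as `det Gν = 1`.
  · refine ⟨_, (h.systemMinor_eq hb C i).trans ?_⟩
    rw [h.det_eq_one, map_one, mul_one]
  · exact h.systemMinor_eq hb C i
  · exact systemZeros_eq_zeros_outputGcd h hb C
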